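/- The height $\mathcal H(\alpha)$ of a real algebraic number $\alpha$ is the maximum of the absolute values of the coefficients of its primitive minimal polynomial over $\mathbb Z$, and $\exp^{[3]}(x)=e^{e^{e^x}}$. For an integer $m\ge 1$, a real number $\xi$ is called an $m$-ultra number if there is a sequence $(\alpha_n)_{n\ge 1}$ of real algebraic numbers of degree $m$ such that $$0<|\xi-\alpha_n|<\bigl(\exp^{[3]}(\mathcal H(\alpha_n))\bigr)^{-n}\qquad (n=1,2,\ldots)$$ (such a sequence necessarily has infinitely many distinct terms). A real number $y$ is a Liouville number if for every $k\ge 1$ there is a rational number $p/q$ with $q>1$ and $0<|y-p/q|<q^{-k}$. A function $f:\mathbb R\to\mathbb R$ is transcendental if the only complex polynomial $P(X,Y)$ with $P(x,f(x))=0$ for all $x\in\mathbb R$ is the zero polynomial. Theorem. For each $m\ge 1$ there are uncountably many real-analytic transcendental functions $\varphi:\mathbb R\to\mathbb R$ such that $\varphi(\xi)$ is a Liouville number for every $m$-ultra number $\xi$. -/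

import Mathlib

open Polynomial

noncomputable section

/-- The primitive minimal polynomial over `ℤ` of a real algebraic number `α`: the primitive part
of the polynomial obtained from the (monic) minimal polynomial over `ℚ` by clearing denominators.
It is well defined up to sign. -/
def primMinpoly (α : ℝ) : ℤ[X] :=
  (IsLocalization.integerNormalization (nonZeroDivisors ℤ) (minpoly ℚ α)).primPart

/-- The height of a real algebraic number: the maximum of the absolute values of the coefficients
of its primitive minimal polynomial over `ℤ`. -/
def algHeight (α : ℝ) : ℕ :=
  (primMinpoly α).support.sup fun i => ((primMinpoly α).coeff i).natAbs

/-- The set of real algebraic numbers of degree exactly `m`. -/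
def realAlgebraicOfDegree (m : ℕ) : Set ℝ :=
  {α | IsAlgebraic ℚ α ∧ (minpoly ℚ α).natDegree = m}

/-- The threefold iterated exponential `exp (exp (exp x))`. -/
def exp3 (x : ℝ) : ℝ := Real.exp (Real.exp (Real.exp x))

/-- `ξ` is an `m`-ultra number: there is a sequence `α 1, α 2, …` of real algebraic numbers of
degree `m` with `0 < |ξ - α n| < exp3 (height (α n)) ^ (-n)` for all `n ≥ 1`. Such a sequence
converges to `ξ` without ever taking the value `ξ`, so it has infinitely many distinct terms. -/
def IsUltraNumber (m : ℕ) (ξ : ℝ) : Prop :=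
  ∃ α : ℕ → ℝ, ∀ n : ℕ, 1 ≤ n →
    α n ∈ realAlgebraicOfDegree m ∧
    0 < |ξ - α n| ∧ |ξ - α n| < exp3 (algHeight (α n)) ^ (-(n : ℤ))

/-- A function `f : ℝ → ℝ` is transcendental if the only complex polynomial `P(X, Y)` with
`P(x, f x) = 0` for all real `x` is the zero polynomial. -/
def IsTranscendentalFunction (f : ℝ → ℝ) : Prop :=
  ∀ P : MvPolynomial (Fin 2) ℂ,
    (∀ x : ℝ, MvPolynomial.eval ![(x : ℂ), (f x : ℂ)] P = 0) → P = 0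

end

/-!
The functions are constructed so that they map every real algebraic number `α` of degree `m` to a
fraction whose denominator `denom m (algHeight α)` is at most a fixed power of `exp3 (algHeight α)`.
If `φ` is such a function and is analytic and nonconstant, and `ξ` is an `m`-ultra number
approximated by `α n`, then the fractions `φ (α n)` differ from `φ ξ` for large `n`, because zeros
of `φ - φ ξ` are isolated, and `|φ ξ - φ (α n)| = O(|ξ - α n|)` is smaller than any given power of
the reciprocal denominator. So `φ ξ` is a Liouville number
(`liouville_apply_of_isUltraNumber`).

For the construction, start from `f x = exp s + exp x` and correct it height by height
(`correctionSum`). At height `H`, add a nonnegative combination of the polynomials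
`(X² + 1) ∏ (X - a)²` (`nodePoly`), where `a` runs through all numbers of degree `m` and height at
most `H` except for one number `b` of height `H`. These polynomials vanish at the numbers treated
before and at the other numbers of height `H`, so the value at `b` can be raised to the next
fraction with the prescribed denominator. The coefficients this takes are small, because distinct
algebraic numbers of bounded degree and height are separated (`one_le_abs_sub_mul_pow`), and the
series of corrections converges to an entire function.

Every correction is nonnegative on `ℝ`, so the result is at least `exp x`, hence transcendental
(`isTranscendentalFunction_of_exp_le`) and nonconstant. Every correction vanishes at the imaginary
unit `i`, so the entire extension still has the value `exp s + exp i` there, and different `s` give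
different functions (`eq_at_I_of_corrected_eq`). Therefore there are uncountably many of them.
-/

/-! ### Primitive minimal polynomials and heights -/

section Height

open IntermediateField

lemma exists_map_integerNormalization_minpoly {α : ℝ} :
    ∃ b : ℤ, b ≠ 0 ∧ (IsLocalization.integerNormalization (nonZeroDivisors ℤ)
      (minpoly ℚ α)).map (algebraMap ℤ ℚ) = C (b : ℚ) * minpoly ℚ α := by
  obtain ⟨b, hb, h⟩ :=
    IsLocalization.integerNormalization_spec (nonZeroDivisors ℤ) (minpoly ℚ α)
  refine ⟨b, nonZeroDivisors.ne_zero hb, ?_⟩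
  rw [h, ← smul_eq_C_mul]
  ext i
  simp

lemma integerNormalization_minpoly_ne_zero {α : ℝ} (h : IsAlgebraic ℚ α) :
    IsLocalization.integerNormalization (nonZeroDivisors ℤ) (minpoly ℚ α) ≠ 0 := by
  obtain ⟨b, hb, hmap⟩ := exists_map_integerNormalization_minpoly (α := α)
  intro h0
  rw [h0, Polynomial.map_zero, eq_comm, mul_eq_zero, C_eq_zero] at hmap
  rcases hmap with h1 | h1
  · exact hb (by exact_mod_cast h1)
  · exact minpoly.ne_zero h.isIntegral h1

lemma primMinpoly_ne_zero (α : ℝ) : primMinpoly α ≠ 0 :=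
  primPart_ne_zero _

lemma aeval_primMinpoly {α : ℝ} (h : IsAlgebraic ℚ α) : aeval α (primMinpoly α) = 0 :=
  aeval_primPart_eq_zero (integerNormalization_minpoly_ne_zero h)
    (IsLocalization.integerNormalization_aeval_eq_zero _ _ (minpoly.aeval ℚ α))

lemma natDegree_primMinpoly (α : ℝ) : (primMinpoly α).natDegree = (minpoly ℚ α).natDegree := by
  obtain ⟨b, hb, hmap⟩ := exists_map_integerNormalization_minpoly (α := α)
  rw [primMinpoly, natDegree_primPart,
    ← natDegree_map_eq_of_injective (f := algebraMap ℤ ℚ) (by simpa using Int.cast_injective), hmap,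
    natDegree_C_mul (by exact_mod_cast hb)]

lemma natAbs_coeff_primMinpoly_le (α : ℝ) (i : ℕ) :
    ((primMinpoly α).coeff i).natAbs ≤ algHeight α := by
  by_cases hi : i ∈ (primMinpoly α).support
  · exact Finset.le_sup (f := fun i => ((primMinpoly α).coeff i).natAbs) hi
  · simp [notMem_support_iff.mp hi]

lemma cauchyBound_map_le {p : ℤ[X]} (hp : p ≠ 0) {H : ℕ}
    (hH : ∀ i, (p.coeff i).natAbs ≤ H) : ((p.map (Int.castRingHom ℂ)).cauchyBound : ℝ) ≤ H+1 := by
  have hinj : Function.Injective (Int.castRingHom ℂ) := Int.cast_injective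
  have hb : (Finset.range (p.map (Int.castRingHom ℂ)).natDegree).sup
      (fun i => ‖(p.map (Int.castRingHom ℂ)).coeff i‖₊) ≤ (H : NNReal) := by
    refine Finset.sup_le fun i _ => ?_
    rw [← NNReal.coe_le_coe, coe_nnnorm, coeff_map, eq_intCast, Complex.norm_intCast,
      ← Int.cast_abs, Int.abs_eq_natAbs]
    rw [Int.cast_natCast, NNReal.coe_natCast]
    exact_mod_cast hH i
  have hl : (1 : NNReal) ≤ ‖(p.map (Int.castRingHom ℂ)).leadingCoeff‖₊ := by
    rw [leadingCoeff_map_of_injective hinj, ← NNReal.coe_le_coe, coe_nnnorm, eq_intCast,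
      Complex.norm_intCast, ← Int.cast_abs, NNReal.coe_one]
    exact_mod_cast Int.one_le_abs (leadingCoeff_ne_zero.2 hp)
  rw [cauchyBound]
  have := (div_le_self (zero_le) hl).trans hb
  exact_mod_cast add_le_add_left this 1

/-- Cauchy's bound, for the complex roots of an integer polynomial. -/
lemma norm_le_of_aeval_eq_zero {p : ℤ[X]} (hp : p ≠ 0) {H : ℕ}
    (hH : ∀ i, (p.coeff i).natAbs ≤ H) {z : ℂ} (hz : aeval z p = 0) : ‖z‖ ≤ H + 1 := by
  have hinj : Function.Injective (Int.castRingHom ℂ) := Int.cast_injective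
  have h := IsRoot.norm_lt_cauchyBound (p := p.map (Int.castRingHom ℂ)) (a := z)
    ((Polynomial.map_ne_zero_iff hinj).2 hp)
    (by rw [IsRoot.def, eval_map]; exact hz)
  refine (NNReal.coe_le_coe.2 h.le).trans ?_
  exact cauchyBound_map_le hp hH

/-! ### Separation of algebraic numbers of bounded degree and height -/

/-- The norm of a nonzero algebraic integer `γ` is a nonzero integer, so `γ` cannot be small if all
its conjugates are bounded by `M`. -/
lemma one_le_abs_mul_pow_finrank {K : IntermediateField ℚ ℝ} [FiniteDimensional ℚ K] {γ : K}
    (hγ : γ ≠ 0) (hint : IsIntegral ℤ γ) {M : ℝ} (hM : 1 ≤ M)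
    (hle : ∀ σ : K →ₐ[ℚ] ℂ, ‖σ γ‖ ≤ M) {D : ℕ} (hD : Module.finrank ℚ K ≤ D) :
    1 ≤ |(γ : ℝ)| * M ^ D := by
  classical
  obtain ⟨z, hz⟩ := IsIntegrallyClosed.isIntegral_iff.1 (Algebra.isIntegral_norm ℚ hint)
  have hz0 : z ≠ 0 := by
    rintro rfl
    rw [map_zero, eq_comm, Algebra.norm_eq_zero_iff] at hz
    exact hγ hz
  have hprod := Algebra.norm_eq_prod_embeddings ℚ ℂ γ
  rw [← hz] at hprod
  have h1 : (1 : ℝ) ≤ ∏ σ : K →ₐ[ℚ] ℂ, ‖σ γ‖ := by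
    rw [← norm_prod, ← hprod]
    simp only [eq_intCast, Rat.cast_intCast, eq_ratCast, Complex.norm_intCast]
    exact_mod_cast Int.one_le_abs hz0
  -- The inclusion `K ⊆ ℝ ⊆ ℂ` contributes `|γ|`, each of the others at most `M`.
  let ι : K →ₐ[ℚ] ℂ := (Complex.ofRealAm.restrictScalars ℚ).comp K.val
  have hι : ‖ι γ‖ = |(γ : ℝ)| := by
    exact Complex.norm_real (γ : ℝ)
  rw [← Finset.mul_prod_erase _ _ (Finset.mem_univ ι), hι] at h1
  refine h1.trans (mul_le_mul_of_nonneg_left ?_ (abs_nonneg _))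
  calc ∏ σ ∈ Finset.univ.erase ι, ‖σ γ‖ ≤ ∏ σ ∈ Finset.univ.erase ι, M :=
        Finset.prod_le_prod (fun _ _ => norm_nonneg _) fun σ _ => hle σ
    _ = M ^ (Finset.univ.erase ι).card := by simp
    _ ≤ M ^ D := by
        refine pow_le_pow_right₀ hM ((Finset.card_le_card (Finset.erase_subset _ _)).trans ?_)
        rw [Finset.card_univ, AlgHom.card]
        exact hD

/-- Distinct real algebraic numbers of degree `m` and height at most `H` are at least
`(2 * H + 2) ^ (-3 * (m ^ 2 + 1))` apart: if `A` and `B` are the leading coefficients of their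
primitive minimal polynomials, then `A * B * (α - β)` is a nonzero algebraic integer of degree at
most `m ^ 2`. -/
lemma one_le_abs_sub_mul_pow {m H : ℕ} {α β : ℝ} (hα : α ∈ realAlgebraicOfDegree m)
    (hβ : β ∈ realAlgebraicOfDegree m) (hHα : algHeight α ≤ H) (hHβ : algHeight β ≤ H)
    (hne : α ≠ β) : 1 ≤ |α - β| * ((2 * H + 2 : ℝ) ^ 3) ^ (m ^ 2 + 1) := by
  let K : IntermediateField ℚ ℝ := ℚ⟮α⟯ ⊔ ℚ⟮β⟯
  have : FiniteDimensional ℚ ℚ⟮α⟯ := adjoin.finiteDimensional hα.1.isIntegral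
  have : FiniteDimensional ℚ ℚ⟮β⟯ := adjoin.finiteDimensional hβ.1.isIntegral
  have hfin : FiniteDimensional ℚ K := inferInstance
  have hrank : Module.finrank ℚ K ≤ m ^ 2 := by
    refine (finrank_sup_le _ _).trans ?_
    rw [adjoin.finrank hα.1.isIntegral, adjoin.finrank hβ.1.isIntegral, hα.2, hβ.2, sq]
  let a : K := ⟨α, (le_sup_left : ℚ⟮α⟯ ≤ K) (mem_adjoin_simple_self ℚ α)⟩
  let b : K := ⟨β, (le_sup_right : ℚ⟮β⟯ ≤ K) (mem_adjoin_simple_self ℚ β)⟩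
  set A : ℤ := (primMinpoly α).leadingCoeff with hA
  set B : ℤ := (primMinpoly β).leadingCoeff with hB
  have hinj : Function.Injective (algebraMap K ℝ) := (algebraMap K ℝ).injective
  have ha : aeval a (primMinpoly α) = 0 := by
    apply hinj
    rw [← aeval_algebraMap_apply, map_zero]
    exact aeval_primMinpoly hα.1
  have hb : aeval b (primMinpoly β) = 0 := by
    apply hinj
    rw [← aeval_algebraMap_apply, map_zero]
    exact aeval_primMinpoly hβ.1
  have hA0 : A ≠ 0 := leadingCoeff_ne_zero.2 (primMinpoly_ne_zero α)
  have hB0 : B ≠ 0 := leadingCoeff_ne_zero.2 (primMinpoly_ne_zero β)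
  have hAH : |(A : ℝ)| ≤ H := by
    rw [← Int.cast_abs, Int.abs_eq_natAbs]
    exact_mod_cast (natAbs_coeff_primMinpoly_le α _).trans hHα
  have hBH : |(B : ℝ)| ≤ H := by
    rw [← Int.cast_abs, Int.abs_eq_natAbs]
    exact_mod_cast (natAbs_coeff_primMinpoly_le β _).trans hHβ
  have hint : IsIntegral ℤ ((A : K) * B * (a - b)) := by
    have h1 : IsIntegral ℤ ((A : K) * a) := by
      simpa [zsmul_eq_mul] using isIntegral_leadingCoeff_smul _ _ ha
    have h2 : IsIntegral ℤ ((B : K) * b) := by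
      simpa [zsmul_eq_mul] using isIntegral_leadingCoeff_smul _ _ hb
    have hAi : IsIntegral ℤ (A : K) := isIntegral_algebraMap (R := ℤ) (x := A)
    have hBi : IsIntegral ℤ (B : K) := isIntegral_algebraMap (R := ℤ) (x := B)
    have h3 : (A : K) * B * (a - b) = B * (A * a) - A * (B * b) := by ring
    rw [h3]
    exact (hBi.mul h1).sub (hAi.mul h2)
  have hγ : (A : K) * B * (a - b) ≠ 0 := by
    refine mul_ne_zero (mul_ne_zero (by exact_mod_cast hA0) (by exact_mod_cast hB0))
      (sub_ne_zero.2 fun h => hne ?_)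
    exact congrArg Subtype.val h
  have hL : (1 : ℝ) ≤ 2 * H + 2 := by have : (0 : ℝ) ≤ H := H.cast_nonneg; linarith
  have hM : (1 : ℝ) ≤ (2 * H + 2 : ℝ) ^ 3 := one_le_pow₀ hL
  have hbd : ∀ σ : K →ₐ[ℚ] ℂ, ‖σ ((A : K) * B * (a - b))‖ ≤ (2 * H + 2 : ℝ) ^ 3 := by
    intro σ
    have h1 : ‖σ a‖ ≤ H + 1 := norm_le_of_aeval_eq_zero (primMinpoly_ne_zero α)
      (fun i => (natAbs_coeff_primMinpoly_le α i).trans hHα)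
      (by
        have := aeval_algHom_apply (σ.restrictScalars ℤ) a (primMinpoly α)
        rw [ha, map_zero] at this; exact this)
    have h2 : ‖σ b‖ ≤ H + 1 := norm_le_of_aeval_eq_zero (primMinpoly_ne_zero β)
      (fun i => (natAbs_coeff_primMinpoly_le β i).trans hHβ)
      (by
        have := aeval_algHom_apply (σ.restrictScalars ℤ) b (primMinpoly β)
        rw [hb, map_zero] at this; exact this)
    rw [map_mul, map_mul, map_sub, map_intCast, map_intCast, norm_mul, norm_mul,
      Complex.norm_intCast, Complex.norm_intCast]
    have h3 : ‖σ a - σ b‖ ≤ 2 * H + 2 := (norm_sub_le _ _).trans (by linarith)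
    calc |(A : ℝ)| * |(B : ℝ)| * ‖σ a - σ b‖
        ≤ (2 * H + 2) * (2 * H + 2) * (2 * H + 2) := by
          gcongr <;> linarith [(Nat.cast_nonneg H : (0 : ℝ) ≤ H)]
      _ = (2 * H + 2 : ℝ) ^ 3 := by ring
  have key := one_le_abs_mul_pow_finrank hγ hint hM hbd hrank
  have hval : (((A : K) * B * (a - b) : K) : ℝ) = A * B * (α - β) := by
    simp [a, b]
  rw [hval, abs_mul, abs_mul] at key
  refine key.trans ?_
  calc |(A : ℝ)| * |(B : ℝ)| * |α - β| * ((2 * H + 2 : ℝ) ^ 3) ^ m ^ 2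
      ≤ (2 * H + 2) ^ 3 * |α - β| * ((2 * H + 2 : ℝ) ^ 3) ^ m ^ 2 := by
        gcongr
        calc |(A : ℝ)| * |(B : ℝ)| ≤ (2 * H + 2) * (2 * H + 2) := by
              gcongr <;> linarith [(Nat.cast_nonneg H : (0 : ℝ) ≤ H)]
          _ = (2 * H + 2 : ℝ) ^ 2 := by ring
          _ ≤ (2 * H + 2 : ℝ) ^ 3 := pow_le_pow_right₀ hL (by norm_num)
    _ = |α - β| * ((2 * H + 2 : ℝ) ^ 3) ^ (m ^ 2 + 1) := by ring

end Height

/-! ### Finiteness of the set of algebraic numbers of bounded degree and height -/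

/-- An upper bound for the number of real algebraic numbers of degree `m` and height at most `H`. -/
def countBound (m H : ℕ) : ℕ := m * (2 * H + 2) ^ (m + 1)

lemma exists_finset_card_le (m H : ℕ) : ∃ S : Finset ℝ, S.card ≤ countBound m H ∧
    ∀ α ∈ realAlgebraicOfDegree m, algHeight α ≤ H → α ∈ S := by
  classical
  -- `T` consists of the possible coefficient vectors, `R` attaches the polynomials to them.
  let T : Finset (Fin (m + 1) → ℤ) := Fintype.piFinset fun _ => Finset.Icc (-(H : ℤ)) H
  let R : (Fin (m + 1) → ℤ) → ℝ[X] := fun f => ∑ i, C (f i : ℝ) * X ^ (i : ℕ)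
  refine ⟨T.biUnion fun f => (R f).roots.toFinset, ?_, ?_⟩
  · have hdeg : ∀ f ∈ T, (R f).roots.toFinset.card ≤ m := by
      intro f _
      refine (Multiset.toFinset_card_le _).trans ((card_roots' _).trans ?_)
      exact natDegree_sum_le_of_forall_le _ _ fun i _ =>
        (natDegree_C_mul_X_pow_le _ _).trans (Nat.lt_succ_iff.1 i.2)
    refine (Finset.card_biUnion_le_card_mul _ _ m hdeg).trans ?_
    rw [countBound, mul_comm]
    refine Nat.mul_le_mul_left _ ?_
    simp only [T, Fintype.card_piFinset, Int.card_Icc, Finset.prod_const, Finset.card_univ,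
      Fintype.card_fin]
    exact Nat.pow_le_pow_left (by omega) _
  · intro α hα hH
    have hdeg : (primMinpoly α).natDegree = m := (natDegree_primMinpoly α).trans hα.2
    have hR : R (fun i => (primMinpoly α).coeff i) = (primMinpoly α).map (Int.castRingHom ℝ) := by
      conv_rhs => rw [(primMinpoly α).as_sum_range' (m + 1) (by omega)]
      simp only [R, Polynomial.map_sum, ← C_mul_X_pow_eq_monomial]
      rw [Finset.sum_range]
      simp
    refine Finset.mem_biUnion.2 ⟨fun i => (primMinpoly α).coeff i, ?_, ?_⟩
    · refine Fintype.mem_piFinset.2 fun i => Finset.mem_Icc.2 ?_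
      have := (natAbs_coeff_primMinpoly_le α i).trans hH
      omega
    · have h0 : (primMinpoly α).map (Int.castRingHom ℝ) ≠ 0 :=
        (Polynomial.map_ne_zero_iff Int.cast_injective).2 (primMinpoly_ne_zero α)
      rw [hR, Multiset.mem_toFinset, mem_roots h0, IsRoot.def, eval_map]
      exact aeval_primMinpoly hα.1

lemma finite_height_le (m H : ℕ) : {α ∈ realAlgebraicOfDegree m | algHeight α ≤ H}.Finite := by
  obtain ⟨S, -, hS⟩ := exists_finset_card_le m H
  exact S.finite_toSet.subset fun α hα => hS α hα.1 hα.2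

/-- The finite set of real algebraic numbers of degree `m` and height at most `H`. -/
noncomputable def heightLE (m H : ℕ) : Finset ℝ := (finite_height_le m H).toFinset

lemma mem_heightLE {m H : ℕ} {α : ℝ} :
    α ∈ heightLE m H ↔ α ∈ realAlgebraicOfDegree m ∧ algHeight α ≤ H := by
  simp [heightLE]

lemma card_heightLE_le (m H : ℕ) : (heightLE m H).card ≤ countBound m H := by
  obtain ⟨S, hc, hS⟩ := exists_finset_card_le m H
  refine (Finset.card_le_card fun α hα => ?_).trans hc
  rw [mem_heightLE] at hα
  exact hS α hα.1 hα.2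

lemma abs_le_of_mem_heightLE {m H : ℕ} {α : ℝ} (hα : α ∈ heightLE m H) : |α| ≤ H + 1 := by
  rw [mem_heightLE] at hα
  have h := norm_le_of_aeval_eq_zero (z := (α : ℂ)) (primMinpoly_ne_zero α)
    (fun i => (natAbs_coeff_primMinpoly_le α i).trans hα.2)
    (by
      have := aeval_algebraMap_apply ℂ α (primMinpoly α)
      rwa [aeval_primMinpoly hα.1.1, map_zero] at this)
  simpa using h

/-- The finite set of real algebraic numbers of degree `m` and height exactly `H`. -/
noncomputable def heightEq (m H : ℕ) : Finset ℝ := (heightLE m H).filter fun α => algHeight α = H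

lemma heightEq_subset (m H : ℕ) : heightEq m H ⊆ heightLE m H := Finset.filter_subset _ _

lemma card_heightEq_le (m H : ℕ) : (heightEq m H).card ≤ countBound m H :=
  (Finset.card_le_card (heightEq_subset m H)).trans (card_heightLE_le m H)

lemma mem_heightEq_algHeight {m : ℕ} {α : ℝ} (hα : α ∈ realAlgebraicOfDegree m) :
    α ∈ heightEq m (algHeight α) :=
  Finset.mem_filter.2 ⟨mem_heightLE.2 ⟨hα, le_rfl⟩, rfl⟩

/-! ### Polynomials with double zeros at the algebraic numbers of bounded height -/

/-- The polynomial `(X² + 1) ∏ (X - a)²`, where `a ≠ b` runs through the numbers of degree `m` and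
height at most `H`. It is nonnegative on `ℝ`, and the factor `X² + 1` makes it vanish at `i`. -/
noncomputable def nodePoly (m H : ℕ) (b : ℝ) : ℝ[X] :=
  (X ^ 2 + 1) * ∏ a ∈ (heightLE m H).erase b, (X - C a) ^ 2

lemma eval_nodePoly (m H : ℕ) (b x : ℝ) : (nodePoly m H b).eval x =
    (x ^ 2 + 1) * ∏ a ∈ (heightLE m H).erase b, (x - a) ^ 2 := by
  simp [nodePoly, eval_prod]

lemma aeval_nodePoly (m H : ℕ) (b : ℝ) (z : ℂ) : aeval z (nodePoly m H b) =
    (z ^ 2 + 1) * ∏ a ∈ (heightLE m H).erase b, (z - a) ^ 2 := by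
  simp [nodePoly, map_prod]

lemma eval_nodePoly_nonneg (m H : ℕ) (b x : ℝ) : 0 ≤ (nodePoly m H b).eval x := by
  rw [eval_nodePoly]
  exact mul_nonneg (by positivity) (Finset.prod_nonneg fun _ _ => sq_nonneg _)

lemma eval_nodePoly_eq_zero {m H : ℕ} {b x : ℝ} (hx : x ∈ heightLE m H) (hxb : x ≠ b) :
    (nodePoly m H b).eval x = 0 := by
  rw [eval_nodePoly, Finset.prod_eq_zero (Finset.mem_erase.2 ⟨hxb, hx⟩) (by simp), mul_zero]

lemma aeval_I_nodePoly (m H : ℕ) (b : ℝ) : aeval Complex.I (nodePoly m H b) = 0 := by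
  simp [aeval_nodePoly]

lemma one_le_two_mul_add_two (H : ℕ) : (1 : ℝ) ≤ 2 * H + 2 := by
  have : (0 : ℝ) ≤ H := H.cast_nonneg
  linarith

lemma card_erase_heightLE_le (m H : ℕ) (b : ℝ) :
    ((heightLE m H).erase b).card ≤ countBound m H :=
  (Finset.card_le_card (Finset.erase_subset _ _)).trans (card_heightLE_le m H)

lemma one_le_eval_nodePoly_mul_pow {m H : ℕ} {b : ℝ} (hb : b ∈ heightLE m H) :
    1 ≤ (nodePoly m H b).eval b * (2 * H + 2 : ℝ) ^ (6 * (m ^ 2 + 1) * countBound m H) := by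
  have hL := one_le_two_mul_add_two H
  have hprod : 1 ≤ (∏ a ∈ (heightLE m H).erase b, (b - a) ^ 2) *
      (2 * H + 2 : ℝ) ^ (6 * (m ^ 2 + 1) * countBound m H) := by
    calc (1 : ℝ) ≤ ∏ a ∈ (heightLE m H).erase b,
          ((b - a) ^ 2 * (2 * H + 2 : ℝ) ^ (6 * (m ^ 2 + 1))) := by
          rw [← Finset.prod_const_one (s := (heightLE m H).erase b)]
          refine Finset.prod_le_prod (fun _ _ => zero_le_one) fun a ha => ?_
          rw [Finset.mem_erase, mem_heightLE] at ha
          rw [mem_heightLE] at hb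
          have h := one_le_abs_sub_mul_pow hb.1 ha.2.1 hb.2 ha.2.2 (Ne.symm ha.1)
          have h2 := one_le_pow₀ h (n := 2)
          rw [mul_pow, sq_abs] at h2
          refine h2.trans_eq ?_
          rw [← pow_mul, ← pow_mul]
          congr 2
          ring
      _ = (∏ a ∈ (heightLE m H).erase b, (b - a) ^ 2) *
          (2 * H + 2 : ℝ) ^ (6 * (m ^ 2 + 1) * ((heightLE m H).erase b).card) := by
          rw [Finset.prod_mul_distrib, Finset.prod_const, ← pow_mul]
      _ ≤ _ := by
          refine mul_le_mul_of_nonneg_left (pow_le_pow_right₀ hL ?_)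
            (Finset.prod_nonneg fun _ _ => sq_nonneg _)
          exact Nat.mul_le_mul_left _ (card_erase_heightLE_le m H b)
  rw [eval_nodePoly, mul_assoc]
  refine hprod.trans (le_mul_of_one_le_left (zero_le_one.trans hprod) ?_)
  linarith [sq_nonneg b]

lemma norm_aeval_nodePoly_le {m H : ℕ} (b : ℝ) {z : ℂ} (hz : ‖z‖ ≤ H) :
    ‖aeval z (nodePoly m H b)‖ ≤ (2 * H + 2 : ℝ) ^ (2 * countBound m H + 2) := by
  have hL := one_le_two_mul_add_two H
  have h1 : ‖z ^ 2 + 1‖ ≤ (2 * H + 2 : ℝ) ^ 2 := by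
    refine (norm_add_le _ _).trans ?_
    rw [norm_pow, norm_one]
    nlinarith [norm_nonneg z]
  have h2 : ∏ a ∈ (heightLE m H).erase b, ‖z - a‖ ^ 2 ≤
      (2 * H + 2 : ℝ) ^ (2 * countBound m H) := by
    calc ∏ a ∈ (heightLE m H).erase b, ‖z - a‖ ^ 2
        ≤ ∏ a ∈ (heightLE m H).erase b, (2 * H + 2 : ℝ) ^ 2 := by
          refine Finset.prod_le_prod (fun _ _ => by positivity) fun a ha => ?_
          have ha' := abs_le_of_mem_heightLE (Finset.mem_of_mem_erase ha)
          gcongr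
          refine (norm_sub_le _ _).trans ?_
          rw [Complex.norm_real, Real.norm_eq_abs]
          linarith
      _ = (2 * H + 2 : ℝ) ^ (2 * ((heightLE m H).erase b).card) := by
          rw [Finset.prod_const, ← pow_mul]
      _ ≤ _ := pow_le_pow_right₀ hL (Nat.mul_le_mul_left _ (card_erase_heightLE_le m H b))
  rw [aeval_nodePoly, norm_mul, norm_prod]
  simp only [norm_pow]
  calc _ ≤ (2 * H + 2 : ℝ) ^ 2 * (2 * H + 2 : ℝ) ^ (2 * countBound m H) := by
        exact mul_le_mul h1 h2 (Finset.prod_nonneg fun _ _ => by positivity) (by positivity)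
    _ = _ := by rw [← pow_add, add_comm 2]

/-! ### Transcendence from growth -/

section Construction

open Filter Topology

/-- A function that is at least `exp` is transcendental: among the monomials of `P(X, Y)`, the one
whose exponents (of `Y`, then of `X`) are lexicographically largest dominates all others along the
graph of the function. -/
lemma isTranscendentalFunction_of_exp_le {f : ℝ → ℝ} (hf : ∀ x, Real.exp x ≤ f x) :
    IsTranscendentalFunction f := by
  intro P hP
  by_contra hP0
  have hne : P.support.Nonempty := by simpa [Finset.nonempty_iff_ne_empty] using hP0
  obtain ⟨e, he, hmax⟩ := P.support.exists_max_image
    (fun d : Fin 2 →₀ ℕ => toLex (d 1, d 0)) hne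
  have hfpos : ∀ x, 0 < f x := fun x => (Real.exp_pos x).trans_le (hf x)
  have hmono : ∀ d ∈ P.support, d ≠ e →
      Tendsto (fun x : ℝ => x ^ d 0 * f x ^ d 1 / (x ^ e 0 * f x ^ e 1)) atTop (𝓝 0) := by
    intro d hd hde
    have hle := hmax d hd
    rw [Prod.Lex.toLex_le_toLex] at hle
    rcases hle with hlt | ⟨heq, hle0⟩
    · simp only at hlt
      have h0 := Real.tendsto_pow_mul_exp_neg_atTop_nhds_zero (d 0)
      refine squeeze_zero' ?_ ?_ h0
      · filter_upwards [eventually_ge_atTop 1] with x hx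
        have := hfpos x
        positivity
      · filter_upwards [eventually_ge_atTop 1] with x hx
        have hx0 : 0 < x := by linarith
        have hfx := hfpos x
        have hf1 : 1 ≤ f x := (Real.one_le_exp hx0.le).trans (hf x)
        rw [Real.exp_neg, ← div_eq_mul_inv, div_le_div_iff₀ (by positivity) (Real.exp_pos x)]
        calc x ^ d 0 * f x ^ d 1 * Real.exp x ≤ x ^ d 0 * f x ^ d 1 * f x := by
              gcongr; exact hf x
          _ = x ^ d 0 * (1 * f x ^ (d 1 + 1)) := by ring
          _ ≤ x ^ d 0 * (x ^ e 0 * f x ^ e 1) := by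
              gcongr
              · exact one_le_pow₀ hx
              · exact hlt
    · simp only at heq hle0
      have hlt : d 0 < e 0 := by
        refine lt_of_le_of_ne hle0 fun h => hde ?_
        ext i
        fin_cases i
        · exact h
        · exact heq
      have h0 : Tendsto (fun x : ℝ => (x ^ (e 0 - d 0))⁻¹) atTop (𝓝 0) :=
        (tendsto_pow_atTop (by omega)).inv_tendsto_atTop
      refine h0.congr' ?_
      filter_upwards [eventually_gt_atTop 0] with x hx
      have hfx := hfpos x
      rw [heq, mul_div_mul_right _ _ (by positivity), inv_eq_one_div,
        div_eq_div_iff (by positivity) (by positivity), one_mul, ← pow_add]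
      congr 1
      omega
  have hsum : Tendsto (fun x : ℝ => ∑ d ∈ P.support,
      P.coeff d * ((x ^ d 0 * f x ^ d 1 / (x ^ e 0 * f x ^ e 1) : ℝ) : ℂ)) atTop
      (𝓝 (∑ d ∈ P.support, if d = e then P.coeff e else 0)) := by
    refine tendsto_finsetSum _ fun d hd => ?_
    split_ifs with hde
    · subst hde
      refine tendsto_const_nhds.congr' ?_
      filter_upwards [eventually_gt_atTop 0] with x hx
      have hfx := hfpos x
      rw [div_self (by positivity), Complex.ofReal_one, mul_one]
    · simpa using ((Complex.continuous_ofReal.tendsto 0).comp (hmono d hd hde)).const_mul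
        (P.coeff d)
  rw [Finset.sum_ite_eq' P.support e, if_pos he] at hsum
  have hzero : (fun x : ℝ => ∑ d ∈ P.support,
      P.coeff d * ((x ^ d 0 * f x ^ d 1 / (x ^ e 0 * f x ^ e 1) : ℝ) : ℂ)) = fun _ => 0 := by
    funext x
    have h := hP x
    rw [MvPolynomial.eval_eq'] at h
    simp only [Fin.prod_univ_two, Matrix.cons_val_zero, Matrix.cons_val_one] at h
    push_cast
    simp_rw [← mul_div_assoc]
    rw [← Finset.sum_div, h, zero_div]
  rw [hzero] at hsum
  exact MvPolynomial.mem_support_iff.1 he (tendsto_nhds_unique hsum tendsto_const_nhds)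

/-! ### Liouville values at ultra numbers -/

lemma two_le_exp3 (x : ℝ) : 2 ≤ exp3 x := by
  have h1 : 1 < Real.exp (Real.exp x) := Real.one_lt_exp_iff.2 (Real.exp_pos x)
  have := Real.add_one_le_exp (Real.exp (Real.exp x))
  unfold exp3
  linarith

/-- A nonconstant analytic function takes Liouville values at all `m`-ultra numbers if it maps the
algebraic numbers of degree `m` to fractions with denominators at most a power of `exp3` of the
height. -/
lemma liouville_apply_of_isUltraNumber {m : ℕ} {φ : ℝ → ℝ} (hφ : AnalyticOnNhd ℝ φ Set.univ)
    (hconst : ∀ c, φ ≠ fun _ => c) {c : ℕ}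
    (hrat : ∀ α ∈ realAlgebraicOfDegree m, ∃ p q : ℤ, 1 < q ∧ φ α = p / q ∧
      (q : ℝ) ≤ exp3 (algHeight α) ^ c) {ξ : ℝ} (hξ : IsUltraNumber m ξ) : Liouville (φ ξ) := by
  obtain ⟨α, hα⟩ := hξ
  have hbound : ∀ n, 1 ≤ n → |ξ - α n| ≤ (1 / 2 : ℝ) ^ n := fun n hn => by
    refine (hα n hn).2.2.le.trans ?_
    rw [zpow_neg, zpow_natCast, one_div, inv_pow]
    have := two_le_exp3 (algHeight (α n))
    gcongr
  have hlim : Tendsto α atTop (𝓝 ξ) := by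
    rw [tendsto_iff_dist_tendsto_zero]
    refine squeeze_zero' (Eventually.of_forall fun _ => dist_nonneg) ?_
      (tendsto_pow_atTop_nhds_zero_of_lt_one (by norm_num) (by norm_num : (1 / 2 : ℝ) < 1))
    filter_upwards [eventually_ge_atTop 1] with n hn
    rw [dist_comm, Real.dist_eq]
    exact hbound n hn
  have hlim' : Tendsto α atTop (𝓝[≠] ξ) := by
    refine tendsto_nhdsWithin_iff.2 ⟨hlim, ?_⟩
    filter_upwards [eventually_ge_atTop 1] with n hn
    intro h
    have := (hα n hn).2.1
    rw [Set.mem_singleton_iff.1 h] at this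
    simp at this
  have hne : ∀ᶠ n in atTop, φ (α n) ≠ φ ξ := by
    rcases (hφ ξ trivial).eventually_eq_or_eventually_ne
      (analyticAt_const (v := φ ξ)) with h | h
    · exact absurd (AnalyticOnNhd.eq_of_eventuallyEq hφ (fun _ _ => analyticAt_const) h)
        (hconst (φ ξ))
    · exact hlim'.eventually h
  obtain ⟨C, hC⟩ := ((hφ ξ trivial).differentiableAt.isBigO_sub.comp_tendsto hlim).bound
  -- The Lipschitz constant `C` at `ξ` is absorbed by `j` spare factors `exp3 _ ≥ 2`.
  obtain ⟨j, hj⟩ := pow_unbounded_of_one_lt C (one_lt_two : (1 : ℝ) < 2)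
  intro k
  obtain ⟨n, hnne, hnC, hn⟩ := (hne.and (hC.and (eventually_ge_atTop (j + c * k + 1)))).exists
  obtain ⟨hdeg, hpos, hlt⟩ := hα n (by omega)
  obtain ⟨p, q, hq, hpq, hqle⟩ := hrat (α n) hdeg
  refine ⟨p, q, hq, fun h => hnne (by rw [hpq, h]), ?_⟩
  rw [← hpq, abs_sub_comm]
  simp only [Function.comp, Real.norm_eq_abs] at hnC
  have hq0 : (0 : ℝ) < q := by exact_mod_cast (by omega : 0 < q)
  set E := exp3 (algHeight (α n)) with hE
  have hE2 : 2 ≤ E := two_le_exp3 _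
  have hE0 : 0 < E := by linarith
  rw [abs_sub_comm ξ] at hpos hlt
  calc |φ (α n) - φ ξ| ≤ C * |α n - ξ| := hnC
    _ ≤ 2 ^ j * |α n - ξ| := by gcongr
    _ < 2 ^ j * E ^ (-(n : ℤ)) := by gcongr
    _ ≤ E ^ j * E ^ (-(n : ℤ)) := by gcongr
    _ = E ^ j / E ^ n := by rw [zpow_neg, zpow_natCast, div_eq_mul_inv]
    _ ≤ 1 / (E ^ c) ^ k := by
        rw [div_le_div_iff₀ (by positivity) (by positivity), one_mul, ← pow_mul, ← pow_add]
        exact pow_le_pow_right₀ (by linarith) (by omega)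
    _ ≤ 1 / (q : ℝ) ^ k := by gcongr

/-! ### Corrections at a given height -/

/-- The coefficients of the corrections made at height `H` are at most
`1 / (2 * H + 2) ^ sizeExponent m H`, which makes these corrections at most `(1 / 2) ^ H` on the
disc of radius `H`. -/
def sizeExponent (m H : ℕ) : ℕ := H + 3 * countBound m H + 2

/-- The common denominator of the prescribed values at the algebraic numbers of degree `m` and
height `H`. The second summand of the exponent makes up for the size of `nodePoly m H b` at `b`. -/
def denom (m H : ℕ) : ℕ :=
  (2 * H + 2) ^ (sizeExponent m H + 6 * (m ^ 2 + 1) * countBound m H)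

lemma two_le_denom (m H : ℕ) : 2 ≤ denom m H :=
  calc 2 ≤ 2 * H + 2 := by omega
    _ ≤ denom m H := Nat.le_self_pow (by unfold sizeExponent; omega) _

/-- The multiple of `nodePoly m H b` that has to be added to a function with value `y` at `b` to
raise this value to the next fraction with denominator `denom m H`. -/
noncomputable def weight (m H : ℕ) (b y : ℝ) : ℝ :=
  (⌈denom m H * y⌉ / denom m H - y) / (nodePoly m H b).eval b

lemma denom_pos (m H : ℕ) : (0 : ℝ) < denom m H := by
  have := two_le_denom m H
  exact_mod_cast (by omega : 0 < denom m H)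

lemma weight_nonneg (m H : ℕ) (b y : ℝ) : 0 ≤ weight m H b y := by
  refine div_nonneg (sub_nonneg.2 ?_) (eval_nodePoly_nonneg _ _ _ _)
  rw [le_div_iff₀ (denom_pos m H), mul_comm]
  exact Int.le_ceil _

lemma eval_nodePoly_pos {m H : ℕ} {b : ℝ} (hb : b ∈ heightLE m H) :
    0 < (nodePoly m H b).eval b :=
  pos_of_mul_pos_left (zero_lt_one.trans_le (one_le_eval_nodePoly_mul_pow hb))
    (by positivity)

lemma weight_le {m H : ℕ} {b : ℝ} (hb : b ∈ heightLE m H) (y : ℝ) :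
    weight m H b y ≤ 1 / (2 * H + 2 : ℝ) ^ sizeExponent m H := by
  have hd := denom_pos m H
  have hL := one_le_two_mul_add_two H
  have hL0 : (0 : ℝ) < 2 * H + 2 := by linarith
  have h1 : (⌈denom m H * y⌉ : ℝ) / denom m H - y ≤ 1 / denom m H := by
    rw [sub_le_iff_le_add, div_le_iff₀ hd, add_mul, div_mul_cancel₀ _ hd.ne', mul_comm y, add_comm]
    exact (Int.ceil_lt_add_one _).le
  rw [weight, div_le_iff₀ (eval_nodePoly_pos hb)]
  refine h1.trans ?_
  rw [div_mul_eq_mul_div, one_mul, div_le_div_iff₀ hd (by positivity), one_mul]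
  have h2 := one_le_eval_nodePoly_mul_pow hb
  have h3 : (denom m H : ℝ) = (2 * H + 2 : ℝ) ^ sizeExponent m H *
      (2 * H + 2 : ℝ) ^ (6 * (m ^ 2 + 1) * countBound m H) := by
    rw [denom, pow_add]
    push_cast
    rfl
  rw [h3]
  calc (2 * H + 2 : ℝ) ^ sizeExponent m H
      ≤ (2 * H + 2 : ℝ) ^ sizeExponent m H * ((nodePoly m H b).eval b *
        (2 * H + 2 : ℝ) ^ (6 * (m ^ 2 + 1) * countBound m H)) :=
        le_mul_of_one_le_right (by positivity) h2
    _ = _ := by ring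

lemma add_weight_mul_eval {m H : ℕ} {b : ℝ} (hb : b ∈ heightLE m H) (y : ℝ) :
    y + weight m H b y * (nodePoly m H b).eval b = ⌈denom m H * y⌉ / denom m H := by
  rw [weight, div_mul_cancel₀ _ (eval_nodePoly_pos hb).ne']
  ring

/-- The correction at height `H`: if added to `f`, it makes the values at all numbers of degree `m`
and height `H` fractions with denominator `denom m H`, without changing those at the numbers of
degree `m` and smaller height. -/
noncomputable def correction (m H : ℕ) (f : ℝ → ℝ) : ℝ[X] :=
  ∑ b ∈ heightEq m H, C (weight m H b (f b)) * nodePoly m H b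

/-- The sum of the successive corrections at the heights less than `H`, starting from `f`. -/
noncomputable def correctionSum (m : ℕ) (f : ℝ → ℝ) : ℕ → ℝ[X]
  | 0 => 0
  | H + 1 => correctionSum m f H +
      correction m H fun x => f x + (correctionSum m f H).eval x

/-- The correction that is added at height `H` when one starts from `f`. -/
noncomputable def correctionTerm (m : ℕ) (f : ℝ → ℝ) (H : ℕ) : ℝ[X] :=
  correction m H fun x => f x + (correctionSum m f H).eval x

lemma correctionSum_eq_sum (m : ℕ) (f : ℝ → ℝ) (H : ℕ) :
    correctionSum m f H = ∑ h ∈ Finset.range H, correctionTerm m f h := by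
  induction H with
  | zero => rfl
  | succ H ih => rw [Finset.sum_range_succ, ← ih]; rfl

lemma eval_correction_nonneg (m H : ℕ) (f : ℝ → ℝ) (x : ℝ) : 0 ≤ (correction m H f).eval x := by
  rw [correction, eval_finsetSum]
  refine Finset.sum_nonneg fun b _ => ?_
  rw [eval_C_mul]
  exact mul_nonneg (weight_nonneg _ _ _ _) (eval_nodePoly_nonneg _ _ _ _)

lemma eval_correction_of_lt {m H : ℕ} (f : ℝ → ℝ) {x : ℝ} (hx : x ∈ realAlgebraicOfDegree m)
    (hlt : algHeight x < H) : (correction m H f).eval x = 0 := by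
  rw [correction, eval_finsetSum]
  refine Finset.sum_eq_zero fun b hb => ?_
  rw [eval_C_mul, eval_nodePoly_eq_zero (mem_heightLE.2 ⟨hx, hlt.le⟩), mul_zero]
  rintro rfl
  exact hlt.ne (Finset.mem_filter.1 hb).2

lemma add_eval_correction {m : ℕ} (f : ℝ → ℝ) {x : ℝ} (hx : x ∈ realAlgebraicOfDegree m) :
    f x + (correction m (algHeight x) f).eval x =
      ⌈denom m (algHeight x) * f x⌉ / denom m (algHeight x) := by
  have hmem := mem_heightEq_algHeight hx
  have hmem' := heightEq_subset _ _ hmem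
  rw [correction, eval_finsetSum, Finset.sum_eq_single_of_mem x hmem, eval_C_mul,
    add_weight_mul_eval hmem']
  intro b _ hbx
  rw [eval_C_mul, eval_nodePoly_eq_zero hmem' hbx.symm, mul_zero]

lemma aeval_I_correction (m H : ℕ) (f : ℝ → ℝ) : aeval Complex.I (correction m H f) = 0 := by
  simp [correction, aeval_I_nodePoly]

lemma norm_aeval_correction_le {m H : ℕ} (f : ℝ → ℝ) {z : ℂ} (hz : ‖z‖ ≤ H) :
    ‖aeval z (correction m H f)‖ ≤ (1 / 2) ^ H := by
  have hL := one_le_two_mul_add_two H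
  have hL0 : (0 : ℝ) < 2 * H + 2 := by linarith
  have hL2 : (2 : ℝ) ≤ 2 * H + 2 := by
    have : (0 : ℝ) ≤ H := H.cast_nonneg
    linarith
  set L : ℝ := 2 * H + 2 with hLdef
  set N := countBound m H with hN
  have hterm : ∀ b ∈ heightEq m H,
      ‖aeval z (C (weight m H b (f b)) * nodePoly m H b)‖ ≤ 1 / L ^ (H + N) := by
    intro b hb
    rw [map_mul, aeval_C, norm_mul, norm_algebraMap', Real.norm_of_nonneg (weight_nonneg _ _ _ _)]
    calc weight m H b (f b) * ‖aeval z (nodePoly m H b)‖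
        ≤ 1 / L ^ sizeExponent m H * L ^ (2 * N + 2) :=
          mul_le_mul (weight_le (heightEq_subset _ _ hb) _) (norm_aeval_nodePoly_le b hz)
            (norm_nonneg _) (by positivity)
      _ = 1 / L ^ (H + N) := by
          rw [div_mul_eq_mul_div, one_mul, div_eq_div_iff (by positivity) (by positivity), one_mul,
            ← pow_add]
          congr 1
          rw [sizeExponent, ← hN]
          omega
  have hNL : (N : ℝ) ≤ L ^ N := by
    calc (N : ℝ) ≤ 2 ^ N := by exact_mod_cast Nat.lt_two_pow_self.le
      _ ≤ L ^ N := by gcongr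
  rw [correction, map_sum]
  calc _ ≤ ∑ b ∈ heightEq m H, ‖aeval z (C (weight m H b (f b)) * nodePoly m H b)‖ :=
        norm_sum_le _ _
    _ ≤ (heightEq m H).card • (1 / L ^ (H + N)) := Finset.sum_le_card_nsmul _ _ _ hterm
    _ ≤ L ^ N * (1 / L ^ (H + N)) := by
        rw [nsmul_eq_mul]
        gcongr
        exact le_trans (by exact_mod_cast card_heightEq_le m H) hNL
    _ = (1 / L) ^ H := by
        rw [pow_add, one_div_pow]
        field_simp
    _ ≤ (1 / 2) ^ H := by gcongr

/-! ### The corrected functions -/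

/-- The function on `ℂ` obtained from `g` by adding all corrections of `f`. It is used for
extensions `g` of `f`. -/
noncomputable def correctedComplex (m : ℕ) (f : ℝ → ℝ) (g : ℂ → ℂ) (z : ℂ) : ℂ :=
  g z + ∑' H, aeval z (correctionTerm m f H)

/-- The function obtained from `f` by adding all corrections. -/
noncomputable def corrected (m : ℕ) (f : ℝ → ℝ) (x : ℝ) : ℝ :=
  f x + ∑' H, (correctionTerm m f H).eval x

lemma aeval_ofReal_eq (p : ℝ[X]) (x : ℝ) : aeval (x : ℂ) p = ((p.eval x : ℝ) : ℂ) := by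
  simpa using aeval_algebraMap_apply ℂ x p

lemma correctedComplex_ofReal {m : ℕ} {f : ℝ → ℝ} {g : ℂ → ℂ} (hfg : ∀ x : ℝ, g x = f x) (x : ℝ) :
    correctedComplex m f g x = corrected m f x := by
  simp only [correctedComplex, corrected, aeval_ofReal_eq, hfg]
  push_cast
  rfl

/-- On the ball of radius `R` the terms with `R ≤ H` are at most `(1 / 2) ^ H`, so the series
converges locally uniformly. -/
lemma differentiable_tsum_correctionTerm (m : ℕ) (f : ℝ → ℝ) :
    Differentiable ℂ fun z : ℂ => ∑' H, aeval z (correctionTerm m f H) := by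
  have hdiff : ∀ p : ℝ[X], Differentiable ℂ fun z : ℂ => aeval z p := fun p =>
    p.differentiable_aeval
  intro z₀
  obtain ⟨R, hR⟩ := exists_nat_gt ‖z₀‖
  have hbound : ∀ H : ℕ, ∃ u : ℝ, (∀ z ∈ Metric.ball (0 : ℂ) R,
      ‖aeval z (correctionTerm m f H)‖ ≤ u) ∧ (R ≤ H → u = (1 / 2) ^ H) := by
    intro H
    by_cases hRH : R ≤ H
    · refine ⟨(1 / 2) ^ H, fun z hz => norm_aeval_correction_le _ ?_, fun _ => rfl⟩
      rw [mem_ball_zero_iff] at hz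
      exact hz.le.trans (by exact_mod_cast hRH)
    · obtain ⟨u, hu⟩ := (isCompact_closedBall (0 : ℂ) R).exists_bound_of_continuousOn
        (hdiff (correctionTerm m f H)).continuous.continuousOn
      exact ⟨u, fun z hz => hu z (Metric.ball_subset_closedBall hz), fun h => absurd h hRH⟩
  choose u hu hu' using hbound
  have hsum : Summable u := by
    refine (summable_nat_add_iff R).1 ?_
    refine ((summable_nat_add_iff R).2 summable_geometric_two).congr fun H => ?_
    rw [hu' _ (Nat.le_add_left _ _)]
  have h := Complex.differentiableOn_tsum_of_summable_norm hsum
    (fun H => (hdiff (correctionTerm m f H)).differentiableOn) Metric.isOpen_ball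
    (fun H z hz => hu H z hz)
  exact h.differentiableAt (Metric.isOpen_ball.mem_nhds (by simpa using hR))

lemma analyticOnNhd_corrected {m : ℕ} {f : ℝ → ℝ} {g : ℂ → ℂ} (hg : Differentiable ℂ g)
    (hfg : ∀ x : ℝ, g x = f x) : AnalyticOnNhd ℝ (corrected m f) Set.univ := by
  intro x _
  have h := ((hg.add (differentiable_tsum_correctionTerm m f)).analyticAt (x : ℂ)).re_ofReal
  refine h.congr (Eventually.of_forall fun y => ?_)
  change (correctedComplex m f g y).re = _
  rw [correctedComplex_ofReal hfg, Complex.ofReal_re]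

lemma le_corrected (m : ℕ) (f : ℝ → ℝ) (x : ℝ) : f x ≤ corrected m f x :=
  le_add_of_nonneg_right (tsum_nonneg fun _ => eval_correction_nonneg _ _ _ _)

/-- The value at `x` is settled once the height of `x` has been treated: all later corrections
vanish there. -/
lemma corrected_eq_div {m : ℕ} (f : ℝ → ℝ) {x : ℝ} (hx : x ∈ realAlgebraicOfDegree m) :
    ∃ p : ℤ, corrected m f x = p / denom m (algHeight x) := by
  refine ⟨⌈denom m (algHeight x) * (f x + (correctionSum m f (algHeight x)).eval x)⌉, ?_⟩
  rw [corrected, tsum_eq_sum (s := Finset.range (algHeight x + 1)), Finset.sum_range_succ,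
    ← eval_finsetSum, ← correctionSum_eq_sum, ← add_assoc]
  · exact add_eval_correction (fun y => f y + (correctionSum m f (algHeight x)).eval y) hx
  · intro H hH
    rw [Finset.mem_range, not_lt] at hH
    exact eval_correction_of_lt _ hx (by omega)

lemma correctedComplex_I (m : ℕ) (f : ℝ → ℝ) (g : ℂ → ℂ) :
    correctedComplex m f g Complex.I = g Complex.I := by
  simp [correctedComplex, correctionTerm, aeval_I_correction]

/-- If two corrected functions coincide, so do their entire extensions, and these have kept their
original values at `i`. -/
lemma eq_at_I_of_corrected_eq {m : ℕ} {f₁ f₂ : ℝ → ℝ} {g₁ g₂ : ℂ → ℂ} (hg₁ : Differentiable ℂ g₁)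
    (hg₂ : Differentiable ℂ g₂) (hfg₁ : ∀ x : ℝ, g₁ x = f₁ x) (hfg₂ : ∀ x : ℝ, g₂ x = f₂ x)
    (h : corrected m f₁ = corrected m f₂) : g₁ Complex.I = g₂ Complex.I := by
  have key : correctedComplex m f₁ g₁ = correctedComplex m f₂ g₂ := by
    refine AnalyticOnNhd.eq_of_frequently_eq (𝕜 := ℂ) (z₀ := 0)
      (fun z _ => (hg₁.add (differentiable_tsum_correctionTerm m f₁)).analyticAt z)
      (fun z _ => (hg₂.add (differentiable_tsum_correctionTerm m f₂)).analyticAt z) ?_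
    have hlim : Tendsto (fun x : ℝ => (x : ℂ)) (𝓝[≠] 0) (𝓝[≠] 0) := by
      refine tendsto_nhdsWithin_iff.2 ⟨?_, ?_⟩
      · exact (Complex.continuous_ofReal.tendsto' 0 0 Complex.ofReal_zero).mono_left
          nhdsWithin_le_nhds
      · filter_upwards [self_mem_nhdsWithin] with x hx
        simpa using hx
    refine hlim.frequently (Eventually.of_forall fun x => ?_).frequently
    rw [correctedComplex_ofReal hfg₁, correctedComplex_ofReal hfg₂, h]
  rw [← correctedComplex_I m f₁ g₁, key, correctedComplex_I]

/-! ### Growth of the denominators -/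

/-- `log (denom m H)` is polynomially bounded in `H`, hence `O(exp H)`; only two of the three
exponentials in `exp3` are needed here. -/
lemma exists_denom_le_exp3_pow (m : ℕ) :
    ∃ c : ℕ, ∀ H : ℕ, (denom m H : ℝ) ≤ exp3 H ^ c := by
  let K : ℕ := 1 + (9 + 6 * m ^ 2) * m
  obtain ⟨c, hc⟩ :=
    exists_nat_ge ((K : ℝ) * 2 ^ (m + 2) * ((m + 2).factorial * Real.exp 1))
  refine ⟨c, fun H => ?_⟩
  have hexponent : sizeExponent m H + 6 * (m ^ 2 + 1) * countBound m H ≤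
      K * (2 * H + 2) ^ (m + 1) := by
    have h : H + 2 ≤ (2 * H + 2) ^ (m + 1) :=
      le_trans (by omega) (Nat.le_self_pow (Nat.succ_ne_zero m) (2 * H + 2))
    simp only [K, sizeExponent, countBound]
    nlinarith
  -- `x ^ k ≤ k! * exp x` at `x = H + 1`
  have hpow : ((H : ℝ) + 1) ^ (m + 2) ≤ (m + 2).factorial * Real.exp 1 * Real.exp H := by
    have h := Real.pow_div_factorial_le_exp ((H : ℝ) + 1) (by positivity) (m + 2)
    rw [div_le_iff₀ (by positivity), add_comm (H : ℝ), Real.exp_add] at h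
    rw [add_comm (H : ℝ)]
    linarith
  have hL : (2 * H + 2 : ℝ) ≤ Real.exp (2 * H + 2) := by
    linarith [Real.add_one_le_exp (2 * H + 2 : ℝ)]
  have hone := one_le_two_mul_add_two H
  calc (denom m H : ℝ)
      = (2 * H + 2 : ℝ) ^ (sizeExponent m H + 6 * (m ^ 2 + 1) * countBound m H) := by
        rw [denom]
        push_cast
        rfl
    _ ≤ (2 * H + 2 : ℝ) ^ (K * (2 * H + 2) ^ (m + 1)) := pow_le_pow_right₀ hone hexponent
    _ ≤ Real.exp (2 * H + 2) ^ (K * (2 * H + 2) ^ (m + 1)) := by gcongr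
    _ = Real.exp (K * 2 ^ (m + 2) * ((H : ℝ) + 1) ^ (m + 2)) := by
        rw [← Real.exp_nat_mul]
        congr 1
        push_cast
        have h : (2 * H + 2 : ℝ) = 2 * (H + 1) := by ring
        rw [h, mul_pow]
        ring
    _ ≤ Real.exp (c * Real.exp (Real.exp H)) := by
        refine Real.exp_le_exp.2 ?_
        calc (K : ℝ) * 2 ^ (m + 2) * ((H : ℝ) + 1) ^ (m + 2)
            ≤ K * 2 ^ (m + 2) * ((m + 2).factorial * Real.exp 1 * Real.exp H) := by gcongr
          _ = K * 2 ^ (m + 2) * ((m + 2).factorial * Real.exp 1) * Real.exp H := by ring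
          _ ≤ c * Real.exp H := by gcongr
          _ ≤ c * Real.exp (Real.exp H) := by
              gcongr
              linarith [Real.add_one_le_exp (H : ℝ)]
    _ = exp3 H ^ c := by rw [exp3, ← Real.exp_nat_mul]

end Construction

theorem theorem1 (m : ℕ) (hm : 1 ≤ m) :
    ¬ Set.Countable {φ : ℝ → ℝ |
      AnalyticOnNhd ℝ φ Set.univ ∧
      IsTranscendentalFunction φ ∧
      φ '' {ξ : ℝ | IsUltraNumber m ξ} ⊆ {y : ℝ | Liouville y}} := by
  intro hcount
  let f : ℝ → ℝ → ℝ := fun s x => Real.exp s + Real.exp x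
  let g : ℝ → ℂ → ℂ := fun s z => (Real.exp s : ℂ) + Complex.exp z
  have hg : ∀ s, Differentiable ℂ (g s) := fun s =>
    (differentiable_const _).add Complex.differentiable_exp
  have hfg : ∀ s (x : ℝ), g s x = f s x := fun s x => by simp [f, g]
  have hinj : Function.Injective fun s => corrected m (f s) := by
    intro s t hst
    have h := eq_at_I_of_corrected_eq (hg s) (hg t) (hfg s) (hfg t) hst
    have h' : (Real.exp s : ℂ) = Real.exp t := add_right_cancel h
    exact Real.exp_injective (Complex.ofReal_injective h')
  have hexp : ∀ s x, Real.exp x ≤ corrected m (f s) x := fun s x =>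
    (le_add_of_nonneg_left (Real.exp_pos s).le).trans (le_corrected m (f s) x)
  obtain ⟨c, hc⟩ := exists_denom_le_exp3_pow m
  refine Cardinal.not_countable_real ((hcount.preimage hinj).mono fun s _ => ?_)
  have han := analyticOnNhd_corrected (m := m) (hg s) (hfg s)
  refine ⟨han, isTranscendentalFunction_of_exp_le (hexp s), ?_⟩
  rintro _ ⟨ξ, hξ, rfl⟩
  refine liouville_apply_of_isUltraNumber han (fun d hd => ?_) (c := c) (fun α hα => ?_) hξ
  · have h := hexp s d
    rw [hd] at h
    linarith [Real.add_one_le_exp d]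
  · obtain ⟨p, hp⟩ := corrected_eq_div (f s) hα
    have := two_le_denom m (algHeight α)
    exact ⟨p, denom m (algHeight α), by omega, by simpa using hp,
      by simpa using hc (algHeight α)⟩
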